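/- Let $X^*$ be the set of words over $X=\{x_0,x_1\}$ (with empty word $\emptyset$) and let $\mathbb R\langle\langle X\rangle\rangle$ be the space of formal power series $c=\sum_{\eta\in X^*}(c,\eta)\eta$, with the shuffle product $\sqcup\!\sqcup$. For a pair $d=(d_L,d_R)$ of series and $\eta\in X^*$ let $\phi_d(\eta)$ be the linear operator on series given by $\phi_d(\emptyset)=\mathrm{id}$, $\phi_d(x_i\eta)=\phi_d(x_i)\circ\phi_d(\eta)$, $\phi_d(x_0)(e)=x_0e$ and $\phi_d(x_1)(e)=x_1(d_L\sqcup\!\sqcup e)+x_0(d_R\sqcup\!\sqcup e)$, and put $c\,\tilde\circ\,d=\sum_{\eta}(c,\eta)\,\phi_d(\eta)(1)$. Let $G$ be the set of pairs $c=(c_L,c_R)$ of series with $(c_L,\emptyset)=1$, with the composition product $$c\circ d=\bigl((c_L\,\tilde\circ\,d)\sqcup\!\sqcup d_L,\ (c_L\,\tilde\circ\,d)\sqcup\!\sqcup d_R+c_R\,\tilde\circ\,d\bigr).$$ Let $a_\eta(c)=(c_R,\eta)$ and $b_\eta(c)=(c_L,\eta)$ be the coordinate maps on $G$, so that $b_\emptyset$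 is the constant $\mathbf 1$. Let $H$ be the free commutative unital real algebra on the $a_\eta$ ($\eta\in X^*$) and the $b_\eta$ ($\eta\ne\emptyset$), with $b_\emptyset=\mathbf 1$, whose elements are regarded as functions on $G$. Let $H_n$ be the span of the monomials of degree $n$, where $\deg b_\eta=2|\eta|_{x_0}+|\eta|_{x_1}$ and $\deg a_\eta=2|\eta|_{x_0}+|\eta|_{x_1}+1$. Theorem. For every $h\in H$ there is exactly one $\Delta h\in H\otimes H$ with $(\Delta h)(c,d)=h(c\circ d)$ for all $c,d\in G$, where $(h'\otimes h'')(c,d)=h'(c)h''(d)$. The map $\Delta$ is an algebra homomorphism, and with $\Delta$ and the counit $\varepsilon$, the algebra homomorphism that vanishes on all $a_\eta$ and on all $b_\eta$ with $\eta\neq\emptyset$, the algebra $H=\bigoplus_{n\ge0}H_n$ is a connected graded commutative Hopf algebra: it is a commutative Hopf algebra, $H_0=\mathbb R\mathbf 1$, $H_kH_l\subseteq H_{k+l}$, $\Delta H_n\subseteq\bigoplus_{k+l=n}H_k\otimes H_l$, $\varepsilon(H_n)=0$ for $n\ge1$, and its antipode $S$ satisfies $S(H_n)\subseteq H_n$ and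 $S(xy)=S(y)S(x)$. Moreover $(G,\circ,(1,0))$ is a group, and the antipode computes its inverses: $h(c^{-1})=(Sh)(c)$ for all $c\in G$ and $h\in H$, in particular for every $h=a_\eta$ and $h=b_\eta$. -/

import Mathlib

open scoped TensorProduct

namespace AffineFeedback

/-! ### Words, series and the shuffle product -/

/-- Words over the alphabet `{x₀, x₁}`; the letter `xᵢ` is `i : Fin 2`. -/
abbrev Word := List (Fin 2)

/-- Formal power series over `{x₀, x₁}` with real coefficients: `c η` is the coefficient
`(c, η)`. Only the vector space structure of this function space is used. -/
abbrev Series := Word → ℝ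

/-- The shuffle product of two words, as a multiset of words (that is, as a polynomial with
coefficients in `ℕ`). -/
def shuffleWord : Word → Word → Multiset Word
  | [], ν => {ν}
  | x :: ξ, [] => {x :: ξ}
  | x :: ξ, y :: ν =>
      (shuffleWord ξ (y :: ν)).map (fun ζ => x :: ζ)
        + (shuffleWord (x :: ξ) ν).map (fun ζ => y :: ζ)
termination_by ξ ν => ξ.length + ν.length

/-- The shuffle product of two series, the bilinear extension of the shuffle product of words:
`(c ⧢ d, η) = ∑_{ξ, ν} (c, ξ) (d, ν) (ξ ⧢ ν, η)`. The sum is finite, see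
`shuffle_support_finite`. -/
noncomputable def shuffle (c d : Series) : Series := fun η =>
  ∑ᶠ p : Word × Word, c p.1 * d p.2 * ((shuffleWord p.1 p.2).count η : ℝ)

/-- Left catenation `c ↦ xᵢ c` by a letter. -/
def prepend (i : Fin 2) (c : Series) : Series
  | [] => 0
  | j :: η => if j = i then c η else 0

/-- The series `1`, that is, the empty word. -/
def oneSeries : Series := fun η => if η = [] then 1 else 0

/-! ### The mixed composition product -/

/-- The endomorphism `φ_d(η)` of the space of series attached to a pair `d = (d_L, d_R)`:
`φ_d(∅) = id`, `φ_d(xᵢη) = φ_d(xᵢ) ∘ φ_d(η)`, `φ_d(x₀)(e) = x₀e` and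
`φ_d(x₁)(e) = x₁(d_L ⧢ e) + x₀(d_R ⧢ e)`. -/
noncomputable def phi (d : Series × Series) : Word → Series → Series
  | [], e => e
  | i :: η, e =>
      if i = 0 then prepend 0 (phi d η e)
      else prepend 1 (shuffle d.1 (phi d η e)) + prepend 0 (shuffle d.2 (phi d η e))

/-- The mixed composition product `∑_η (c, η) φ_d(η)(1)`. The sum is finite in each
coefficient, see `mixedComp_support_finite`. -/
noncomputable def mixedComp (c : Series) (d : Series × Series) : Series := fun ν =>
  ∑ᶠ η : Word, c η * phi d η oneSeries ν

/-- The composition product on pairs of series. -/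
noncomputable def pairComp (c d : Series × Series) : Series × Series :=
  (shuffle (mixedComp c.1 d) d.1, shuffle (mixedComp c.1 d) d.2 + mixedComp c.2 d)

/-! ### Finiteness of the sums and constant terms -/

theorem length_of_mem_shuffleWord (ξ ν : Word) :
    ∀ ζ ∈ shuffleWord ξ ν, ζ.length = ξ.length + ν.length := by
  induction ξ, ν using shuffleWord.induct with
  | case1 ν => intro ζ h; simp_all [shuffleWord]
  | case2 x ξ => intro ζ h; simp_all [shuffleWord]
  | case3 x ξ y ν ih1 ih2 =>
    intro ζ h
    rw [shuffleWord, Multiset.mem_add, Multiset.mem_map, Multiset.mem_map] at h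
    rcases h with ⟨a, ha, rfl⟩ | ⟨a, ha, rfl⟩
    · have := ih1 a ha; simp_all; omega
    · have := ih2 a ha; simp_all; omega

theorem count_shuffleWord_eq_zero {ξ ν η : Word} (h : η.length ≠ ξ.length + ν.length) :
    (shuffleWord ξ ν).count η = 0 :=
  Multiset.count_eq_zero.2 fun hm => h (length_of_mem_shuffleWord ξ ν η hm)

theorem shuffle_support_finite (c d : Series) (η : Word) :
    (Function.support fun p : Word × Word =>
      c p.1 * d p.2 * ((shuffleWord p.1 p.2).count η : ℝ)).Finite := by
  refine ((List.finite_length_le (Fin 2) η.length).prod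
    (List.finite_length_le (Fin 2) η.length)).subset ?_
  rintro ⟨ξ, ν⟩ hp
  have h : η.length = ξ.length + ν.length := by
    by_contra h
    exact hp (by simp [count_shuffleWord_eq_zero h])
  exact ⟨by simp only [Set.mem_ofPred_eq]; omega, by simp only [Set.mem_ofPred_eq]; omega⟩

theorem shuffle_nil (c d : Series) : shuffle c d [] = c [] * d [] := by
  unfold shuffle
  rw [finsum_eq_single _ (([], []) : Word × Word)]
  · simp [shuffleWord]
  · rintro ⟨ξ, ν⟩ hne
    rw [count_shuffleWord_eq_zero]
    · simp
    · intro h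
      apply hne
      simp only [List.length_nil] at h
      rw [List.length_eq_zero_iff.1 (by omega : ξ.length = 0),
        List.length_eq_zero_iff.1 (by omega : ν.length = 0)]

theorem shuffle_eq_zero {c d : Series} {n : ℕ} (hd : ∀ ν : Word, ν.length < n → d ν = 0)
    (η : Word) (hη : η.length < n) : shuffle c d η = 0 := by
  unfold shuffle
  rw [← finsum_zero (α := Word × Word)]
  refine finsum_congr ?_
  rintro ⟨ξ, ν⟩
  by_cases h : η.length = ξ.length + ν.length
  · simp only
    rw [hd ν (by omega)]
    simp
  · simp [count_shuffleWord_eq_zero h]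

theorem prepend_eq_zero {c : Series} {n : ℕ} (hc : ∀ ν : Word, ν.length < n → c ν = 0)
    (i : Fin 2) (η : Word) (hη : η.length < n + 1) : prepend i c η = 0 := by
  cases η with
  | nil => rfl
  | cons j η =>
    simp only [List.length_cons] at hη
    simp [prepend, hc η (by omega)]

theorem phi_eq_zero (d : Series × Series) (η : Word) :
    ∀ ν : Word, ν.length < η.length → phi d η oneSeries ν = 0 := by
  induction η with
  | nil => intro ν h; simp at h
  | cons i η ih =>
    intro ν h
    simp only [List.length_cons] at h
    rw [phi]
    split_ifs
    · exact prepend_eq_zero ih 0 ν h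
    · rw [Pi.add_apply, prepend_eq_zero (shuffle_eq_zero ih) 1 ν h,
        prepend_eq_zero (shuffle_eq_zero ih) 0 ν h, add_zero]

theorem mixedComp_support_finite (c : Series) (d : Series × Series) (ν : Word) :
    (Function.support fun η : Word => c η * phi d η oneSeries ν).Finite := by
  refine (List.finite_length_le (Fin 2) ν.length).subset ?_
  intro η hη
  by_contra h
  simp only [Set.mem_ofPred_eq, not_le] at h
  exact hη (by simp [phi_eq_zero d η ν h])

theorem mixedComp_nil (c : Series) (d : Series × Series) : mixedComp c d [] = c [] := by
  unfold mixedComp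
  rw [finsum_eq_single _ ([] : Word)]
  · simp [phi, oneSeries]
  · intro η hη
    rw [phi_eq_zero d η [] (by simpa using List.length_pos_iff.2 hη), mul_zero]

/-! ### The group -/

/-- Pairs of series `(c_L, c_R)` with `(c_L, ∅) = 1`. -/
abbrev FeedbackGroup := {c : Series × Series // c.1 [] = 1}

/-- The composition product restricted to pairs with `(c_L, ∅) = 1`. -/
noncomputable def comp (c d : FeedbackGroup) : FeedbackGroup :=
  ⟨pairComp c.1 d.1, by
    show shuffle (mixedComp c.1.1 d.1) d.1.1 [] = 1
    rw [shuffle_nil, mixedComp_nil, c.2, d.2, one_mul]⟩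

/-- The pair `(1, 0)`. -/
def unitPair : FeedbackGroup := ⟨(oneSeries, 0), by simp [oneSeries]⟩

/-! ### The algebra of coordinate maps -/

/-- The free generators: `a_η` for every word `η`, and `b_η` for every nonempty word `η`
(on pairs with `(c_L, ∅) = 1` the coordinate map `b_∅` is the constant function `1`). -/
inductive Gen
  | a (η : Word)
  | b (η : Word) (hη : η ≠ [])

/-- `deg b_η = 2|η|_{x₀} + |η|_{x₁}` and `deg a_η = 2|η|_{x₀} + |η|_{x₁} + 1`. -/
def deg : Gen → ℕ
  | .a η => 2 * η.count 0 + η.count 1 + 1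
  | .b η _ => 2 * η.count 0 + η.count 1

/-- The free commutative real algebra on the coordinate maps. -/
abbrev H := MvPolynomial Gen ℝ

/-- The right coordinate map `a_η` as an element of `H`. -/
noncomputable def a (η : Word) : H := MvPolynomial.X (Gen.a η)

/-- The left coordinate map `b_η` as an element of `H`; `b_∅ = 1`. -/
noncomputable def b (η : Word) : H :=
  if hη : η = [] then 1 else MvPolynomial.X (Gen.b η hη)

/-- `H_n`: the span of the monomials of degree `n`. -/
noncomputable def Hn (n : ℕ) : Submodule ℝ H :=
  MvPolynomial.weightedHomogeneousSubmodule ℝ deg n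

/-- The value of a generator at a pair of series. -/
def Gen.value (c : FeedbackGroup) : Gen → ℝ
  | .a η => c.1.2 η
  | .b η _ => c.1.1 η

/-- The character `Φ_c` of `H`: evaluation of polynomials in the coordinate maps at `c`. -/
noncomputable def eval (c : FeedbackGroup) : H →ₐ[ℝ] ℝ := MvPolynomial.aeval (Gen.value c)

theorem eval_a (c : FeedbackGroup) (η : Word) : eval c (a η) = c.1.2 η := by
  simp [eval, a, Gen.value]

theorem eval_b (c : FeedbackGroup) (η : Word) : eval c (b η) = c.1.1 η := by
  unfold b
  split_ifs with h
  · rw [map_one, h, c.2]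
  · simp [eval, Gen.value]

/-- An element of `H ⊗ H` as a function of two group elements:
`(h ⊗ k)(c, d) = h(c) k(d)`. -/
noncomputable def eval₂ (c d : FeedbackGroup) : H ⊗[ℝ] H →ₐ[ℝ] ℝ :=
  Algebra.TensorProduct.productMap (eval c) (eval d)

/-- The counit: it vanishes on every generator `a_η`, and on `b_η` for `η ≠ ∅`. -/
noncomputable def counit : H →ₐ[ℝ] ℝ := MvPolynomial.aeval fun _ => 0

/-! ### Hopf algebras -/

section Hopf

variable {R A : Type*} [CommRing R] [CommRing A] [Algebra R A]

/-- `Δ`, `ε` and `S` are the coproduct, counit and antipode of a Hopf algebra structure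
on the given commutative algebra `A`. -/
def IsHopf (Δ : A →ₐ[R] A ⊗[R] A) (ε : A →ₐ[R] R) (S : A →ₗ[R] A) : Prop :=
  ∃ h_coassoc h_rTensor h_lTensor, ∃ hopf : HopfAlgebra R A,
    hopf.toBialgebra = Bialgebra.ofAlgHom Δ ε h_coassoc h_rTensor h_lTensor ∧
    ∀ x, hopf.antipode x = S x

/-- `Δ`, `ε` and `S` make `A = ⨁ₙ 𝒜 n` a connected graded Hopf algebra. -/
structure IsConnectedGradedHopf (𝒜 : ℕ → Submodule R A)
    (Δ : A →ₐ[R] A ⊗[R] A) (ε : A →ₐ[R] R) (S : A →ₗ[R] A) : Prop where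
  isHopf : IsHopf Δ ε S
  gradedAlgebra : Nonempty (GradedAlgebra 𝒜)
  connected : 𝒜 0 = Submodule.span R {1}
  comul_mem : ∀ n, ∀ x ∈ 𝒜 n,
    Δ x ∈ ⨆ p ∈ Finset.HasAntidiagonal.antidiagonal n,
      LinearMap.range (TensorProduct.map (𝒜 p.1).subtype (𝒜 p.2).subtype)
  counit_eq_zero : ∀ n, n ≠ 0 → ∀ x ∈ 𝒜 n, ε x = 0
  antipode_mem : ∀ n, ∀ x ∈ 𝒜 n, S x ∈ 𝒜 n

end Hopf

end AffineFeedback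

namespace AffineFeedback

/-! `H` is the algebra of polynomial functions on `FeedbackGroup`. Every assignment of reals to the
generators comes from a pair of series, so evaluations separate the elements of `H`
(`eval_injective`), and hence of `H ⊗ H` and `H ⊗ H ⊗ H` (`productMap_separates`). Coassociativity,
counit and antipode laws thus reduce to associativity, unit and inverses for `comp`.

The group laws rest on left derivatives. Each derivative is a derivation of the shuffle product
(`shuffle_cons`) and acts on `mixedComp` by a two-line recursion (`tail_one_mixedComp`,
`tail_zero_mixedComp`). Comparing derivatives shows that `mixedComp · d` respects shuffles and that
composing two such maps is the map of `pairComp` (`mixedComp_mixedComp`); associativity follows. For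
inverses, `e ↦ (e õ d) ⧢ g` is linear and unitriangular for the weight `wt`, so it can be solved by
recursion on the weight (`solve_spec`).

Finally, each coefficient of a composite or an inverse must be a polynomial in the coordinates, of
the right degree. Both facts come from one induction over an abstract graded algebra of functions:
the coefficient at `ν` lies in degree `wt ν + k`, with shift `k = 0` for left and `k = 1` for right
components. -/

/-- The left derivative `c ↦ xᵢ⁻¹ c` of a series by a letter. -/
def tail (i : Fin 2) (c : Series) : Series := fun η => c (i :: η)

theorem tail_add (i : Fin 2) (c d : Series) : tail i (c + d) = tail i c + tail i d := rfl

theorem tail_prepend_self (i : Fin 2) (c : Series) : tail i (prepend i c) = c := by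
  funext η; simp [tail, prepend]

theorem tail_prepend_of_ne {i j : Fin 2} (h : j ≠ i) (c : Series) :
    tail j (prepend i c) = 0 := by
  funext η; simp [tail, prepend, h]

theorem tail_oneSeries (i : Fin 2) : tail i oneSeries = 0 := by
  funext η; simp [tail, oneSeries]

/-! ### The shuffle product as a recursion on the argument -/

theorem count_cons_map_cons (i j : Fin 2) (η : Word) (s : Multiset Word) :
    (s.map (fun ζ => j :: ζ)).count (i :: η) = if j = i then s.count η else 0 := by
  split_ifs with h
  · subst h
    exact Multiset.count_map_eq_count' _ _ (List.cons_injective) _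
  · rw [Multiset.count_eq_zero]
    intro hm
    obtain ⟨ζ, _, hζ⟩ := Multiset.mem_map.1 hm
    exact h (List.cons.inj hζ).1

theorem shuffleWord_nil_right (ξ : Word) : shuffleWord ξ [] = {ξ} := by
  cases ξ <;> simp [shuffleWord]

/-- The part of `∂ᵢ (ξ ⧢ ν)` in which the letter is removed from the left factor. -/
def headCount (i : Fin 2) (η : Word) : Word → Word → ℕ
  | [], _ => 0
  | x :: ξ, ν => if x = i then (shuffleWord ξ ν).count η else 0

theorem shuffleWord_comm (ξ ν : Word) : shuffleWord ξ ν = shuffleWord ν ξ := by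
  induction ξ, ν using shuffleWord.induct with
  | case1 ν => rw [shuffleWord_nil_right]; simp [shuffleWord]
  | case2 x ξ => simp [shuffleWord]
  | case3 x ξ y ν ih1 ih2 => rw [shuffleWord, shuffleWord, ih1, ih2, add_comm]

/-- The first letter of a word in a shuffle is taken from one of the two factors; the second summand
counts the case of the right factor, with the arguments exchanged. -/
theorem count_shuffleWord_cons (i : Fin 2) (η ξ ν : Word) :
    (shuffleWord ξ ν).count (i :: η) = headCount i η ξ ν + headCount i η ν ξ := by
  cases ξ with
  | nil =>
    cases ν with
    | nil => simp [shuffleWord, headCount]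
    | cons y ν =>
      rw [shuffleWord]
      simp only [headCount, shuffleWord_nil_right, Multiset.count_singleton, zero_add,
        List.cons.injEq]
      by_cases h : y = i
      · simp [h]
      · simp [h, Ne.symm h]
  | cons x ξ =>
    cases ν with
    | nil =>
      rw [shuffleWord]
      simp only [headCount, shuffleWord_nil_right, Multiset.count_singleton, add_zero,
        List.cons.injEq]
      by_cases h : x = i
      · simp [h]
      · simp [h, Ne.symm h]
    | cons y ν =>
      rw [shuffleWord, Multiset.count_add, count_cons_map_cons, count_cons_map_cons]
      simp only [headCount]
      rw [shuffleWord_comm (x :: ξ) ν]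

theorem headCount_eq_zero {i : Fin 2} {η ξ ν : Word} (h : ξ.length + ν.length ≠ η.length + 1) :
    headCount i η ξ ν = 0 := by
  cases ξ with
  | nil => rfl
  | cons x ξ =>
    simp only [headCount]
    split_ifs
    · exact count_shuffleWord_eq_zero (by simp only [List.length_cons] at h; omega)
    · rfl

theorem headCount_support_finite (i : Fin 2) (η : Word) (f : Word × Word → ℝ) :
    (Function.support fun p : Word × Word => f p * (headCount i η p.1 p.2 : ℝ)).Finite := by
  refine ((List.finite_length_le (Fin 2) (η.length + 1)).prod
    (List.finite_length_le (Fin 2) (η.length + 1))).subset ?_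
  rintro ⟨ξ, ν⟩ hp
  have h : ξ.length + ν.length = η.length + 1 := by
    by_contra h
    exact hp (by simp [headCount_eq_zero h])
  exact ⟨by simp only [Set.mem_ofPred_eq]; omega, by simp only [Set.mem_ofPred_eq]; omega⟩

theorem finsum_eq_finsum_comp {α β : Type*} {f : α → ℝ} {g : β → α}
    (hg : Function.Injective g) (h : ∀ x, x ∉ Set.range g → f x = 0) :
    ∑ᶠ x, f x = ∑ᶠ y, f (g y) := by
  rw [← finsum_mem_range hg]
  refine finsum_congr fun x => ?_
  by_cases hx : x ∈ Set.range g
  · simp only [hx, finsum_true]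
  · rw [h x hx]
    simp

theorem finsum_headCount (c d : Series) (i : Fin 2) (η : Word) :
    ∑ᶠ p : Word × Word, c p.1 * d p.2 * (headCount i η p.1 p.2 : ℝ) = shuffle (tail i c) d η := by
  have hinj : Function.Injective (fun p : Word × Word => ((i :: p.1, p.2) : Word × Word)) := by
    rintro ⟨a, b⟩ ⟨a', b'⟩ h
    simp_all
  rw [finsum_eq_finsum_comp hinj]
  · exact finsum_congr fun p => by simp [headCount, tail]
  · rintro ⟨ξ, ν⟩ h
    cases ξ with
    | nil => simp [headCount]
    | cons x ξ =>
      have hx : x ≠ i := fun hx => h ⟨(ξ, ν), by rw [hx]⟩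
      simp [headCount, hx]

theorem shuffle_swap (c d : Series) : shuffle c d = shuffle d c := by
  funext η
  unfold shuffle
  rw [← finsum_comp_equiv (Equiv.prodComm Word Word)]
  refine finsum_congr fun p => ?_
  simp only [Equiv.prodComm_apply, Prod.fst_swap, Prod.snd_swap]
  rw [shuffleWord_comm, mul_comm (c p.2)]

/-- Removing a letter is a derivation of the shuffle product. With `shuffle_nil` this determines the
product recursively, so its algebraic laws follow by induction on the word, for all series at once.
-/
theorem shuffle_cons (c d : Series) (i : Fin 2) (η : Word) :
    shuffle c d (i :: η) = shuffle (tail i c) d η + shuffle c (tail i d) η := by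
  rw [← finsum_headCount, shuffle_swap c (tail i d), ← finsum_headCount,
    ← finsum_comp_equiv (Equiv.prodComm Word Word) (f := fun p : Word × Word =>
      d p.1 * c p.2 * (headCount i η p.1 p.2 : ℝ)), ← finsum_add_distrib]
  · refine finsum_congr fun p => ?_
    rw [count_shuffleWord_cons]
    simp only [Equiv.prodComm_apply, Prod.fst_swap, Prod.snd_swap]
    push_cast
    ring
  · exact headCount_support_finite i η fun p => c p.1 * d p.2
  · exact (headCount_support_finite i η fun p => d p.1 * c p.2).preimage
      (Equiv.prodComm Word Word).injective.injOn

theorem tail_shuffle (i : Fin 2) (c d : Series) :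
    tail i (shuffle c d) = shuffle (tail i c) d + shuffle c (tail i d) :=
  funext fun η => shuffle_cons c d i η

/-- Locality of the shuffle product: it allows an induction hypothesis on short words to be used
underneath a shuffle. -/
theorem shuffle_congr {c c' d d' : Series} (ν : Word)
    (hc : ∀ μ : Word, μ.length ≤ ν.length → c μ = c' μ)
    (hd : ∀ μ : Word, μ.length ≤ ν.length → d μ = d' μ) : shuffle c d ν = shuffle c' d' ν := by
  induction ν generalizing c c' d d' with
  | nil => rw [shuffle_nil, shuffle_nil, hc _ le_rfl, hd _ le_rfl]
  | cons i ν ih =>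
    have hl : ∀ μ : Word, μ.length ≤ ν.length → μ.length ≤ (i :: ν).length :=
      fun μ h => h.trans (Nat.le_succ _)
    rw [shuffle_cons, shuffle_cons,
      ih (c := tail i c) (c' := tail i c') (fun μ h => hc _ (Nat.succ_le_succ h))
        fun μ h => hd _ (hl μ h),
      ih (d := tail i d) (d' := tail i d') (fun μ h => hc _ (hl μ h))
        fun μ h => hd _ (Nat.succ_le_succ h)]

theorem add_shuffle (c c' d : Series) : shuffle (c + c') d = shuffle c d + shuffle c' d := by
  funext ν
  induction ν generalizing c c' d with
  | nil => simp only [Pi.add_apply, shuffle_nil]; ring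
  | cons i ν ih =>
    simp only [Pi.add_apply, shuffle_cons, tail_add] at ih ⊢
    rw [ih, ih]; ring

theorem shuffle_add (c d d' : Series) : shuffle c (d + d') = shuffle c d + shuffle c d' := by
  rw [shuffle_swap, add_shuffle, shuffle_swap d, shuffle_swap d']

theorem zero_shuffle (d : Series) : shuffle 0 d = 0 := by
  have h := add_shuffle 0 0 d
  rw [add_zero] at h
  simpa using h

theorem shuffle_zero (d : Series) : shuffle d 0 = 0 := by
  rw [shuffle_swap, zero_shuffle]

theorem one_shuffle (c : Series) : shuffle oneSeries c = c := by
  funext ν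
  induction ν generalizing c with
  | nil => simp [shuffle_nil, oneSeries]
  | cons i ν ih => rw [shuffle_cons, tail_oneSeries, zero_shuffle, ih]; simp [tail]

theorem shuffle_one (c : Series) : shuffle c oneSeries = c := by
  rw [shuffle_swap, one_shuffle]

theorem shuffle_assoc (c d e : Series) :
    shuffle (shuffle c d) e = shuffle c (shuffle d e) := by
  funext ν
  induction ν generalizing c d e with
  | nil => simp only [shuffle_nil]; ring
  | cons i ν ih =>
    simp only [shuffle_cons, tail_shuffle, add_shuffle, shuffle_add, Pi.add_apply, ih]
    ring

theorem shuffle_left_comm (c d e : Series) :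
    shuffle c (shuffle d e) = shuffle d (shuffle c e) := by
  rw [← shuffle_assoc, shuffle_swap c, shuffle_assoc]

/-- Continuity of the shuffle product on locally finite sums. Finiteness is part of the induction
because splitting the sum after the Leibniz rule requires it. -/
theorem shuffle_finsum {ι : Type*} (k : ι → ℝ) (d : Series) (e : ι → Series) (ν : Word)
    (he : ∀ ν, {j | e j ν ≠ 0}.Finite) :
    {j | shuffle d (e j) ν ≠ 0}.Finite ∧
      shuffle d (fun μ => ∑ᶠ j, k j * e j μ) ν = ∑ᶠ j, k j * shuffle d (e j) ν := by
  induction ν generalizing d e with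
  | nil =>
    refine ⟨(he []).subset fun j hj h => hj ?_, ?_⟩
    · rw [shuffle_nil, h, mul_zero]
    · rw [shuffle_nil, mul_finsum]
      exact finsum_congr fun j => by rw [shuffle_nil, mul_left_comm]
  | cons i ν ih =>
    obtain ⟨h1, h2⟩ := ih (tail i d) e he
    obtain ⟨h3, h4⟩ := ih d (fun j => tail i (e j)) fun ν => he (i :: ν)
    refine ⟨(h1.union h3).subset fun j hj => ?_, ?_⟩
    · by_contra h
      simp only [Set.mem_union, Set.mem_ofPred_eq, not_or, not_not] at h
      exact hj (by rw [shuffle_cons, h.1, h.2, add_zero])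
    · rw [shuffle_cons, h2]
      refine (congrArg _ h4).trans ?_
      rw [← finsum_add_distrib]
      · exact finsum_congr fun j => by rw [shuffle_cons]; ring
      · exact h1.subset fun j hj h => hj (by simp [h])
      · exact h3.subset fun j hj h => hj (by simp [h])

/-! ### The mixed composition product as a recursion on the argument -/

theorem phi_zero_cons (d : Series × Series) (η : Word) (e : Series) :
    phi d (0 :: η) e = prepend 0 (phi d η e) := by simp [phi]

theorem phi_one_cons (d : Series × Series) (η : Word) (e : Series) :
    phi d (1 :: η) e =
      prepend 1 (shuffle d.1 (phi d η e)) + prepend 0 (shuffle d.2 (phi d η e)) := by simp [phi]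

theorem phi_locally_finite (d : Series × Series) (ν : Word) :
    {η | phi d η oneSeries ν ≠ 0}.Finite := by
  refine (List.finite_length_le (Fin 2) ν.length).subset fun η hη => ?_
  by_contra h
  simp only [Set.mem_ofPred_eq, not_le] at h
  exact hη (phi_eq_zero d η ν h)

/-- A finite sum over words splits according to the first letter. -/
theorem finsum_word (f : Word → ℝ) (hf : f.support.Finite) :
    ∑ᶠ η, f η = f [] + (∑ᶠ η, f (0 :: η)) + ∑ᶠ η, f (1 :: η) := by
  -- Each part becomes a sum over all words, cut off by a condition on the first letter, so that the
  -- three can be added termwise.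
  have hc : ∀ i : Fin 2, ∑ᶠ η, f (i :: η) =
      ∑ᶠ η : Word, if η.head? = some i then f η else 0 := fun i => by
    rw [finsum_eq_finsum_comp (f := fun η : Word => if η.head? = some i then f η else 0)
      (List.cons_injective (a := i))]
    · simp
    · rintro (_ | ⟨j, η⟩) h
      · simp
      · have hj : j ≠ i := fun hj => h ⟨η, by rw [hj]⟩
        simp [hj]
  have hn : f [] = ∑ᶠ η : Word, if η.head? = none then f η else 0 := by
    rw [finsum_eq_single _ ([] : Word)]
    · simp
    · intro η h
      simp [h]
  rw [hc, hc, hn, ← finsum_add_distrib, ← finsum_add_distrib]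
  · refine finsum_congr fun η => ?_
    rcases η with _ | ⟨j, η⟩
    · simp
    · fin_cases j <;> simp
  · exact hf.subset fun η h h0 => h (by simp [h0])
  · exact hf.subset fun η h h0 => h (by simp [h0])
  · exact hf.subset fun η h h0 => h (by simp [h0])
  · exact hf.subset fun η h h0 => h (by simp [h0])

theorem mixedComp_cons (c : Series) (d : Series × Series) (i : Fin 2) (ν : Word) :
    mixedComp c d (i :: ν) = ∑ᶠ η, tail 0 c η * tail i (phi d (0 :: η) oneSeries) ν +
      ∑ᶠ η, tail 1 c η * tail i (phi d (1 :: η) oneSeries) ν := by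
  unfold mixedComp
  rw [finsum_word _ (mixedComp_support_finite c d (i :: ν))]
  simp [phi, oneSeries, tail]

/-- Only `φ_d(x₁)` creates a leading `x₁`, in front of a shuffle with `d_L`; that shuffle is then
pulled out of the sum over words. -/
theorem tail_one_mixedComp (c : Series) (d : Series × Series) :
    tail 1 (mixedComp c d) = shuffle d.1 (mixedComp (tail 1 c) d) := by
  funext ν
  rw [tail, mixedComp_cons]
  simp only [phi_zero_cons, phi_one_cons, tail_add, tail_prepend_self,
    tail_prepend_of_ne (show (1 : Fin 2) ≠ 0 by decide), add_zero, Pi.zero_apply, mul_zero,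
    finsum_zero, zero_add]
  exact (shuffle_finsum _ _ _ ν (phi_locally_finite d)).2.symm

theorem tail_zero_mixedComp (c : Series) (d : Series × Series) :
    tail 0 (mixedComp c d) =
      mixedComp (tail 0 c) d + shuffle d.2 (mixedComp (tail 1 c) d) := by
  funext ν
  rw [tail, mixedComp_cons]
  simp only [phi_zero_cons, phi_one_cons, tail_add, tail_prepend_self,
    tail_prepend_of_ne (show (0 : Fin 2) ≠ 1 by decide), zero_add]
  exact congrArg _ (shuffle_finsum _ _ _ ν (phi_locally_finite d)).2.symm

theorem mixedComp_add (c c' : Series) (d : Series × Series) :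
    mixedComp (c + c') d = mixedComp c d + mixedComp c' d := by
  funext ν
  simp only [mixedComp, Pi.add_apply]
  rw [← finsum_add_distrib (mixedComp_support_finite c d ν) (mixedComp_support_finite c' d ν)]
  exact finsum_congr fun η => by ring

theorem zero_mixedComp (d : Series × Series) : mixedComp 0 d = 0 := by
  funext ν
  simp [mixedComp]

theorem one_mixedComp (d : Series × Series) : mixedComp oneSeries d = oneSeries := by
  funext ν
  cases ν with
  | nil => rw [mixedComp_nil]
  | cons i ν =>
    change tail i (mixedComp oneSeries d) ν = tail i oneSeries ν
    fin_cases i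
    · simp [tail_zero_mixedComp, tail_oneSeries, zero_mixedComp, shuffle_zero]
    · simp [tail_one_mixedComp, tail_oneSeries, zero_mixedComp, shuffle_zero]

theorem mixedComp_one (c : Series) : mixedComp c (oneSeries, 0) = c := by
  funext ν
  induction ν generalizing c with
  | nil => rw [mixedComp_nil]
  | cons i ν ih =>
    change tail i (mixedComp c _) ν = tail i c ν
    fin_cases i
    · simp [tail_zero_mixedComp, zero_shuffle, ih]
    · simp [tail_one_mixedComp, one_shuffle, ih]

/-- To prove two series equal at a word, one may remove the first letter. -/
theorem apply_eq_of_tail {c d : Series} (ν : Word) (h : c [] = d [])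
    (h0 : ∀ μ : Word, μ.length < ν.length → tail 0 c μ = tail 0 d μ)
    (h1 : ∀ μ : Word, μ.length < ν.length → tail 1 c μ = tail 1 d μ) : c ν = d ν := by
  cases ν with
  | nil => exact h
  | cons i ν =>
    fin_cases i
    · exact h0 ν (Nat.lt_succ_self _)
    · exact h1 ν (Nat.lt_succ_self _)

/-- Both sides have the same constant term and, by the Leibniz rule, satisfy the same recursion
under derivatives. -/
theorem shuffle_mixedComp (c c' : Series) (d : Series × Series) :
    mixedComp (shuffle c c') d = shuffle (mixedComp c d) (mixedComp c' d) := by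
  suffices H : ∀ (n : ℕ) (c c' : Series) (ν : Word), ν.length < n →
      mixedComp (shuffle c c') d ν = shuffle (mixedComp c d) (mixedComp c' d) ν from
    funext fun ν => H _ c c' ν (Nat.lt_succ_self _)
  intro n
  induction n with
  | zero => intro c c' ν h; omega
  | succ n ih =>
    intro c c' ν hν
    refine apply_eq_of_tail ν (by simp only [mixedComp_nil, shuffle_nil]) ?_ ?_
    · intro μ hμ
      -- The hypothesis is needed under a shuffle, hence at all words up to the length of `μ`; this
      -- is why the induction runs over a length bound.
      have h1 : ∀ e c c' : Series, shuffle e (mixedComp (shuffle c c') d) μ =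
          shuffle e (shuffle (mixedComp c d) (mixedComp c' d)) μ := fun e c c' =>
        shuffle_congr μ (fun _ _ => rfl) fun ζ hζ => ih c c' ζ (by omega)
      simp only [tail_zero_mixedComp, tail_shuffle, mixedComp_add, shuffle_add, add_shuffle,
        Pi.add_apply, h1]
      rw [ih _ _ μ (by omega), ih _ _ μ (by omega), shuffle_assoc,
        shuffle_left_comm (mixedComp c d) d.2]
      ring
    · intro μ hμ
      have h1 : ∀ e c c' : Series, shuffle e (mixedComp (shuffle c c') d) μ =
          shuffle e (shuffle (mixedComp c d) (mixedComp c' d)) μ := fun e c c' =>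
        shuffle_congr μ (fun _ _ => rfl) fun ζ hζ => ih c c' ζ (by omega)
      simp only [tail_one_mixedComp, tail_shuffle, mixedComp_add, shuffle_add,
        Pi.add_apply, h1]
      rw [shuffle_assoc, shuffle_left_comm (mixedComp c d) d.1]

/-- Differentiating the left side produces `(d_L õ e) ⧢ e_L` for `x₁` and `(d_L õ e) ⧢ e_R + d_R õ
e` for `x₀`: exactly the two components of `pairComp d e`. -/
theorem mixedComp_mixedComp (c : Series) (d e : Series × Series) :
    mixedComp (mixedComp c d) e = mixedComp c (pairComp d e) := by
  suffices H : ∀ (n : ℕ) (c : Series) (ν : Word), ν.length < n →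
      mixedComp (mixedComp c d) e ν = mixedComp c (pairComp d e) ν from
    funext fun ν => H _ c ν (Nat.lt_succ_self _)
  intro n
  induction n with
  | zero => intro c ν h; omega
  | succ n ih =>
    intro c ν hν
    have h1 : ∀ (f c : Series) (μ : Word), μ.length < ν.length →
        shuffle f (mixedComp c (pairComp d e)) μ = shuffle f (mixedComp (mixedComp c d) e) μ :=
      fun f c μ hμ => shuffle_congr μ (fun _ _ => rfl) fun ζ hζ => (ih c ζ (by omega)).symm
    refine apply_eq_of_tail ν (by simp only [mixedComp_nil]) ?_ ?_
    · intro μ hμ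
      simp only [tail_zero_mixedComp, tail_one_mixedComp, mixedComp_add, shuffle_mixedComp,
        Pi.add_apply, h1 _ _ μ hμ, ← ih (tail 0 c) μ (by omega)]
      simp only [pairComp, add_shuffle, Pi.add_apply]
      rw [shuffle_swap (mixedComp d.1 e) e.2, shuffle_assoc]
      ring
    · intro μ hμ
      simp only [tail_one_mixedComp, shuffle_mixedComp, h1 _ _ μ hμ]
      simp only [pairComp]
      rw [shuffle_swap (mixedComp d.1 e) e.1, shuffle_assoc]

/-! ### The monoid -/

theorem comp_assoc (c d e : FeedbackGroup) : comp (comp c d) e = comp c (comp d e) := by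
  apply Subtype.ext
  refine Prod.ext ?_ ?_
  · simp only [comp, pairComp, shuffle_mixedComp, mixedComp_mixedComp, shuffle_assoc]
  · simp only [comp, pairComp, shuffle_mixedComp, mixedComp_mixedComp, shuffle_assoc,
      mixedComp_add, shuffle_add, add_assoc]

theorem unit_comp (c : FeedbackGroup) : comp unitPair c = c := by
  apply Subtype.ext
  refine Prod.ext ?_ ?_
  · simp only [comp, pairComp, unitPair, one_mixedComp, one_shuffle]
  · simp only [comp, pairComp, unitPair, one_mixedComp, one_shuffle, zero_mixedComp, add_zero]

theorem comp_unit (c : FeedbackGroup) : comp c unitPair = c := by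
  apply Subtype.ext
  refine Prod.ext ?_ ?_
  · simp only [comp, pairComp, unitPair, mixedComp_one, shuffle_one]
  · simp only [comp, pairComp, unitPair, mixedComp_one, shuffle_zero, zero_add]

/-! ### Weights of words and triangularity -/

/-- The weight `2|η|_{x₀} + |η|_{x₁}` of a word. -/
def wt (η : Word) : ℕ := 2 * η.count 0 + η.count 1

theorem wt_zero_cons (η : Word) : wt (0 :: η) = wt η + 2 := by
  simp [wt]; ring

theorem wt_one_cons (η : Word) : wt (1 :: η) = wt η + 1 := by
  simp [wt]; ring

/-- The weight of a letter. -/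
def letterWt (i : Fin 2) : ℕ := if i = 0 then 2 else 1

theorem wt_cons (i : Fin 2) (η : Word) : wt (i :: η) = wt η + letterWt i := by
  fin_cases i
  · exact wt_zero_cons η
  · exact wt_one_cons η

theorem letterWt_pos (i : Fin 2) : 0 < letterWt i := by
  fin_cases i <;> simp [letterWt]

theorem wt_pos {η : Word} (hη : η ≠ []) : 0 < wt η := by
  cases η with
  | nil => exact absurd rfl hη
  | cons i η => rw [wt_cons]; have := letterWt_pos i; omega

/-- All other terms pair `e` with a proper subword of `ν`, which has smaller weight. -/
theorem shuffle_apply_of_forall_wt_lt {e g : Series} {ν : Word}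
    (he : ∀ μ, wt μ < wt ν → e μ = 0) : shuffle e g ν = e ν * g [] := by
  induction ν generalizing e g with
  | nil => rw [shuffle_nil]
  | cons i ν ih =>
    have hi := letterWt_pos i
    rw [wt_cons] at he
    rw [shuffle_cons, ih (e := tail i e) fun μ h => he _ (by rw [wt_cons]; omega),
      ih fun μ h => he μ (by omega), he ν (by omega), zero_mul, add_zero, tail]

/-- When `(d_L, ∅) = 1`, `φ_d(η)(1)` is `η` plus words of larger weight. Length would not do:
`φ_d(x₁)` can turn `x₁` into `x₀`, which keeps the length but raises the weight. -/
theorem mixedComp_apply_of_forall_wt_lt {d : Series × Series} (hd : d.1 [] = 1) {e : Series}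
    {ν : Word} (he : ∀ μ, wt μ < wt ν → e μ = 0) : mixedComp e d ν = e ν := by
  induction hn : wt ν using Nat.strong_induction_on generalizing e ν with
  | _ n ih =>
  subst hn
  cases ν with
  | nil => rw [mixedComp_nil]
  | cons i ν =>
    change tail i (mixedComp e d) ν = tail i e ν
    fin_cases i
    · change tail 0 (mixedComp e d) ν = tail 0 e ν
      change ∀ μ, wt μ < wt (0 :: ν) → e μ = 0 at he
      change ∀ m < wt (0 :: ν), _ at ih
      rw [wt_zero_cons] at he ih
      -- Equality of weights is allowed here because `x₁μ` is still lighter than `x₀ν`; this kills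
      -- the `d_R` term.
      have h1 : ∀ μ, wt μ ≤ wt ν → mixedComp (tail 1 e) d μ = 0 := fun μ h => by
        rw [ih (wt μ) (by omega) (e := tail 1 e) (fun ζ hζ => he _ (by rw [wt_one_cons]; omega)) rfl]
        exact he _ (by rw [wt_one_cons]; omega)
      rw [tail_zero_mixedComp, Pi.add_apply,
        ih (wt ν) (by omega) (e := tail 0 e) (fun ζ hζ => he _ (by rw [wt_zero_cons]; omega)) rfl,
        shuffle_swap, shuffle_apply_of_forall_wt_lt fun μ h => h1 μ h.le, h1 ν le_rfl,
        zero_mul, add_zero]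
    · change tail 1 (mixedComp e d) ν = tail 1 e ν
      change ∀ μ, wt μ < wt (1 :: ν) → e μ = 0 at he
      change ∀ m < wt (1 :: ν), _ at ih
      rw [wt_one_cons] at he ih
      have h1 : ∀ μ, wt μ ≤ wt ν → mixedComp (tail 1 e) d μ = tail 1 e μ := fun μ h =>
        ih (wt μ) (by omega) (fun ζ hζ => he _ (by rw [wt_one_cons]; omega)) rfl
      rw [tail_one_mixedComp, shuffle_swap, shuffle_apply_of_forall_wt_lt, h1 ν le_rfl, hd,
        mul_one]
      intro μ h
      rw [h1 μ h.le]
      exact he _ (by rw [wt_one_cons]; omega)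

/-- The solution `e` of the triangular linear equation `(e õ d) ⧢ g = f`. -/
noncomputable def solve (g : Series) (d : Series × Series) (f : Series) (ν : Word) : ℝ :=
  f ν - shuffle (mixedComp (fun η => if _ : wt η < wt ν then solve g d f η else 0) d) g ν
termination_by wt ν

theorem solve_apply (g : Series) (d : Series × Series) (f : Series) (ν : Word) :
    solve g d f ν = f ν -
      shuffle (mixedComp (fun η => if _ : wt η < wt ν then solve g d f η else 0) d) g ν := by
  conv_lhs => rw [solve]

theorem solve_spec {g : Series} {d : Series × Series} (hg : g [] = 1) (hd : d.1 [] = 1)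
    (f : Series) : shuffle (mixedComp (solve g d f) d) g = f := by
  funext ν
  -- The lighter part `t` contributes the term subtracted in `solve`; the rest `r` contributes only
  -- its own coefficient at `ν`.
  set t : Series := fun η => if _ : wt η < wt ν then solve g d f η else 0 with ht
  set r : Series := fun η => if wt η < wt ν then 0 else solve g d f η with hr
  have hs : solve g d f = t + r := by
    funext η
    by_cases h : wt η < wt ν <;> simp [ht, hr, h]
  have hr0 : ∀ μ, wt μ < wt ν → r μ = 0 := fun μ h => by simp [hr, h]
  have hm : ∀ μ, wt μ < wt ν → mixedComp r d μ = 0 := fun μ h => by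
    rw [mixedComp_apply_of_forall_wt_lt hd fun ζ hζ => hr0 ζ (hζ.trans h), hr0 μ h]
  have hν : r ν = f ν - shuffle (mixedComp t d) g ν := by
    simp only [hr, lt_irrefl, if_false]
    rw [solve_apply]
  rw [hs, mixedComp_add, add_shuffle, Pi.add_apply, shuffle_apply_of_forall_wt_lt hm,
    mixedComp_apply_of_forall_wt_lt hd hr0, hg, hν]
  ring

/-! ### The group -/

/-- The left component of the inverse of `c`. -/
noncomputable def invLeft (c : Series × Series) : Series := solve c.1 c oneSeries

/-- The right component of the inverse of `c`. -/
noncomputable def invRight (c : Series × Series) : Series :=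
  solve oneSeries c (-shuffle (mixedComp (invLeft c) c) c.2)

theorem invLeft_spec {c : Series × Series} (hc : c.1 [] = 1) :
    shuffle (mixedComp (invLeft c) c) c.1 = oneSeries := solve_spec hc hc _

theorem invRight_spec {c : Series × Series} (hc : c.1 [] = 1) :
    mixedComp (invRight c) c = -shuffle (mixedComp (invLeft c) c) c.2 := by
  have h := solve_spec (g := oneSeries) (by simp [oneSeries]) hc
    (-shuffle (mixedComp (invLeft c) c) c.2)
  rwa [shuffle_one] at h

/-- The inverse of `c` for the composition product. -/
noncomputable def inverse (c : FeedbackGroup) : FeedbackGroup :=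
  ⟨(invLeft c.1, invRight c.1), by
    have h := congrFun (invLeft_spec c.2) []
    simpa [shuffle_nil, mixedComp_nil, c.2, oneSeries] using h⟩

theorem inverse_comp (c : FeedbackGroup) : comp (inverse c) c = unitPair := by
  apply Subtype.ext
  refine Prod.ext (invLeft_spec c.2) ?_
  simp only [comp, pairComp, inverse, unitPair, invRight_spec c.2, add_neg_cancel]

/-- The group law on pairs of series given by the composition product. -/
noncomputable abbrev feedbackGroup : Group FeedbackGroup :=
  letI : Mul FeedbackGroup := ⟨comp⟩
  letI : One FeedbackGroup := ⟨unitPair⟩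
  letI : Inv FeedbackGroup := ⟨inverse⟩
  Group.ofLeftAxioms comp_assoc unit_comp inverse_comp

/-- `solve` gives left inverses, as `comp` is linear in its left factor only; that they are also
right inverses is pure group theory. -/
theorem comp_inverse (c : FeedbackGroup) : comp c (inverse c) = unitPair :=
  letI := feedbackGroup
  mul_inv_cancel c

/-! ### Homogeneous dependence on parameters -/

section Homogeneous

variable {X : Type*} {F : ℕ → Submodule ℝ (X → ℝ)}

/-- The coefficient at `ν` of the family of series `u` lies in the piece `F (wt ν + k)`. -/
def IsHomogeneousAt (F : ℕ → Submodule ℝ (X → ℝ)) (u : X → Series) (k : ℕ) (ν : Word) : Prop :=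
  (fun x => u x ν) ∈ F (wt ν + k)

theorem IsHomogeneousAt.tail {u : X → Series} {k : ℕ} {i : Fin 2} {ν : Word}
    (h : IsHomogeneousAt F u k (i :: ν)) :
    IsHomogeneousAt F (fun x => tail i (u x)) (k + letterWt i) ν := by
  unfold IsHomogeneousAt at h ⊢
  rw [wt_cons] at h
  rwa [show wt ν + (k + letterWt i) = wt ν + letterWt i + k by ring]

variable [SetLike.GradedMonoid F]

/-- A derivative moves the weight of the letter into the shift, so both Leibniz terms keep the same
total degree. -/
theorem isHomogeneousAt_shuffle {u v : X → Series} {k l : ℕ} {ν : Word}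
    (hu : ∀ μ : Word, μ.length ≤ ν.length → IsHomogeneousAt F u k μ)
    (hv : ∀ μ : Word, μ.length ≤ ν.length → IsHomogeneousAt F v l μ) :
    IsHomogeneousAt F (fun x => shuffle (u x) (v x)) (k + l) ν := by
  induction ν generalizing u v k l with
  | nil =>
    have h := SetLike.GradedMul.mul_mem (hu [] le_rfl) (hv [] le_rfl)
    unfold IsHomogeneousAt
    rw [show wt [] + k + (wt [] + l) = wt [] + (k + l) by simp [wt]] at h
    simp only [shuffle_nil]
    exact h
  | cons i ν ih =>
    have hl : ∀ μ : Word, μ.length ≤ ν.length → μ.length ≤ (i :: ν).length :=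
      fun μ h => h.trans (Nat.le_succ _)
    have h1 := ih (u := fun x => tail i (u x)) (fun μ h => (hu (i :: μ) (Nat.succ_le_succ h)).tail)
      fun μ h => hv μ (hl μ h)
    have h2 := ih (v := fun x => tail i (v x)) (fun μ h => hu μ (hl μ h))
      fun μ h => (hv (i :: μ) (Nat.succ_le_succ h)).tail
    unfold IsHomogeneousAt at h1 h2 ⊢
    simp only [shuffle_cons]
    rw [show wt ν + (k + letterWt i + l) = wt (i :: ν) + (k + l) by rw [wt_cons]; ring] at h1
    rw [show wt ν + (k + (l + letterWt i)) = wt (i :: ν) + (k + l) by rw [wt_cons]; ring] at h2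
    exact add_mem h1 h2

theorem isHomogeneousAt_mixedComp {d : X → Series × Series}
    (hL : ∀ μ, IsHomogeneousAt F (fun x => (d x).1) 0 μ)
    (hR : ∀ μ, IsHomogeneousAt F (fun x => (d x).2) 1 μ) {u : X → Series} {k : ℕ}
    (hu : ∀ μ, IsHomogeneousAt F u k μ) (ν : Word) :
    IsHomogeneousAt F (fun x => mixedComp (u x) (d x)) k ν := by
  induction hn : ν.length using Nat.strong_induction_on generalizing u k ν with
  | _ n ih =>
  subst hn
  cases ν with
  | nil =>
    unfold IsHomogeneousAt
    simp only [mixedComp_nil]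
    exact hu []
  | cons i ν =>
    have hlt : ∀ μ : Word, μ.length ≤ ν.length → μ.length < (i :: ν).length :=
      fun μ h => Nat.lt_succ_of_le h
    have h0 := ih _ (hlt ν le_rfl) (fun μ => (hu (0 :: μ)).tail) ν rfl
    have h1 := fun (μ : Word) (h : μ.length ≤ ν.length) =>
      ih _ (hlt μ h) (fun μ => (hu (1 :: μ)).tail) μ rfl
    have hL1 := isHomogeneousAt_shuffle (fun μ _ => hL μ) h1
    have hR1 := isHomogeneousAt_shuffle (fun μ _ => hR μ) h1
    unfold IsHomogeneousAt at h0 hL1 hR1 ⊢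
    fin_cases i
    · change (fun x => tail 0 (mixedComp (u x) (d x)) ν) ∈ F (wt (0 :: ν) + k)
      simp only [tail_zero_mixedComp]
      rw [show wt ν + (k + letterWt 0) = wt (0 :: ν) + k by rw [wt_cons]; ring] at h0
      -- The degrees match because `x₀` weighs as much as `x₁` together with the shift 1 of `d_R`.
      rw [show wt ν + (1 + (k + letterWt 1)) = wt (0 :: ν) + k by
        rw [wt_zero_cons]; simp [letterWt]; ring] at hR1
      exact add_mem h0 hR1
    · change (fun x => tail 1 (mixedComp (u x) (d x)) ν) ∈ F (wt (1 :: ν) + k)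
      simp only [tail_one_mixedComp]
      rw [show wt ν + (0 + (k + letterWt 1)) = wt (1 :: ν) + k by rw [wt_cons]; ring] at hL1
      exact hL1

theorem isHomogeneousAt_solve {d : X → Series × Series}
    (hL : ∀ μ, IsHomogeneousAt F (fun x => (d x).1) 0 μ)
    (hR : ∀ μ, IsHomogeneousAt F (fun x => (d x).2) 1 μ) {f g : X → Series} {k : ℕ}
    (hg : ∀ μ, IsHomogeneousAt F g 0 μ) (hf : ∀ μ, IsHomogeneousAt F f k μ) (ν : Word) :
    IsHomogeneousAt F (fun x => solve (g x) (d x) (f x)) k ν := by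
  induction hn : wt ν using Nat.strong_induction_on generalizing ν with
  | _ n ih =>
  subst hn
  have ht : ∀ μ, IsHomogeneousAt F
      (fun x η => if _ : wt η < wt ν then solve (g x) (d x) (f x) η else 0) k μ := by
    intro μ
    unfold IsHomogeneousAt
    by_cases h : wt μ < wt ν
    · simp only [h, dite_true]
      exact ih _ h μ rfl
    · simp only [h, dite_false]
      exact zero_mem _
  have hs := isHomogeneousAt_shuffle (ν := ν)
    (fun μ _ => isHomogeneousAt_mixedComp hL hR ht μ) (fun μ _ => hg μ)
  unfold IsHomogeneousAt at hs ⊢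
  convert sub_mem (hf ν) hs using 1
  exact funext fun x => solve_apply _ _ _ _

theorem isHomogeneousAt_one (ν : Word) : IsHomogeneousAt F (fun _ => oneSeries) 0 ν := by
  unfold IsHomogeneousAt
  by_cases h : ν = []
  · subst h
    exact SetLike.GradedOne.one_mem (A := F)
  · simp only [oneSeries, h, if_false]
    exact zero_mem _

theorem isHomogeneousAt_inverse {c : X → FeedbackGroup}
    (hL : ∀ μ, IsHomogeneousAt F (fun x => (c x).1.1) 0 μ)
    (hR : ∀ μ, IsHomogeneousAt F (fun x => (c x).1.2) 1 μ) (ν : Word) :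
    IsHomogeneousAt F (fun x => (inverse (c x)).1.1) 0 ν ∧
      IsHomogeneousAt F (fun x => (inverse (c x)).1.2) 1 ν := by
  have hI : ∀ μ, IsHomogeneousAt F (fun x => (inverse (c x)).1.1) 0 μ :=
    isHomogeneousAt_solve hL hR hL isHomogeneousAt_one
  refine ⟨hI ν, isHomogeneousAt_solve hL hR isHomogeneousAt_one (fun μ => ?_) ν⟩
  have h := isHomogeneousAt_shuffle (ν := μ)
    (fun μ _ => isHomogeneousAt_mixedComp hL hR hI μ) fun μ _ => hR μ
  rw [zero_add] at h
  exact neg_mem h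

theorem isHomogeneousAt_comp {c d : X → FeedbackGroup}
    (hcL : ∀ μ, IsHomogeneousAt F (fun x => (c x).1.1) 0 μ)
    (hcR : ∀ μ, IsHomogeneousAt F (fun x => (c x).1.2) 1 μ)
    (hdL : ∀ μ, IsHomogeneousAt F (fun x => (d x).1.1) 0 μ)
    (hdR : ∀ μ, IsHomogeneousAt F (fun x => (d x).1.2) 1 μ) (ν : Word) :
    IsHomogeneousAt F (fun x => (comp (c x) (d x)).1.1) 0 ν ∧
      IsHomogeneousAt F (fun x => (comp (c x) (d x)).1.2) 1 ν := by
  have hm := fun μ => isHomogeneousAt_mixedComp hdL hdR hcL μ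
  refine ⟨isHomogeneousAt_shuffle (fun μ _ => hm μ) fun μ _ => hdL μ, ?_⟩
  have h := isHomogeneousAt_shuffle (ν := ν) (fun μ _ => hm μ) fun μ _ => hdR μ
  rw [zero_add] at h
  exact add_mem h (isHomogeneousAt_mixedComp hdL hdR hcR ν)

end Homogeneous

/-! ### Evaluations separate points -/

theorem eval_injective {h k : H} (hk : ∀ c, eval c h = eval c k) : h = k := by
  refine MvPolynomial.funext fun x => ?_
  let c : FeedbackGroup :=
    ⟨(fun η => if hη : η = [] then 1 else x (Gen.b η hη), fun η => x (Gen.a η)), by simp⟩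
  have hc : Gen.value c = x := by
    funext g
    cases g with
    | a η => rfl
    | b η hη => simp [Gen.value, c, hη]
  have h1 := hk c
  simpa [eval, hc, MvPolynomial.aeval_eq_eval] using h1

/-- If two families of characters separate the points of two algebras, then the products of
these characters separate the points of the tensor product. -/
theorem productMap_separates {K A B ι κ : Type*} [Field K] [CommRing A] [Algebra K A]
    [CommRing B] [Algebra K B] {f : ι → A →ₐ[K] K} {g : κ → B →ₐ[K] K}
    (hf : ∀ x y, (∀ i, f i x = f i y) → x = y) (hg : ∀ x y, (∀ j, g j x = g j y) → x = y)
    {s t : A ⊗[K] B} (hst : ∀ i j, Algebra.TensorProduct.productMap (f i) (g j) s =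
      Algebra.TensorProduct.productMap (f i) (g j) t) : s = t := by
  classical
  set 𝒞 := Module.Basis.ofVectorSpace K B
  set e := TensorProduct.equivFinsuppOfBasisRight (M := A) 𝒞
  -- In a basis of `B` a tensor is a finite family of coefficients in `A`. Applying `f i` to them
  -- gives an element of `B`, which the `g j` detect; the `f i` then detect each coefficient.
  have key : ∀ (i : ι) (j : κ) (t : A ⊗[K] B),
      Algebra.TensorProduct.productMap (f i) (g j) t =
        g j (𝒞.repr.symm (Finsupp.mapRange (f i) (map_zero _) (e t))) := by
    intro i j t
    induction t with
    | zero => simp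
    | add x y hx hy =>
      rw [map_add, hx, hy, map_add, Finsupp.mapRange_add (map_add (f i)), map_add, map_add]
    | tmul x y =>
      rw [Algebra.TensorProduct.productMap_apply_tmul]
      have : Finsupp.mapRange (f i) (map_zero _) (e (x ⊗ₜ y)) = f i x • 𝒞.repr y := by
        ext k
        simp [e, mul_comm]
      rw [this, map_smul, LinearEquiv.symm_apply_apply, map_smul, smul_eq_mul]
  apply e.injective
  ext k
  refine hf _ _ fun i => ?_
  have h : Finsupp.mapRange (f i) (map_zero _) (e s) =
      Finsupp.mapRange (f i) (map_zero _) (e t) :=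
    𝒞.repr.symm.injective (hg _ _ fun j => by rw [← key, ← key, hst])
  simpa using DFunLike.congr_fun h k

theorem eval₂_injective {s t : H ⊗[ℝ] H} (h : ∀ c d, eval₂ c d s = eval₂ c d t) : s = t :=
  productMap_separates (fun _ _ => eval_injective) (fun _ _ => eval_injective) h

/-- The evaluation of `H ⊗ (H ⊗ H)` at three group elements. -/
noncomputable def eval₃ (c d e : FeedbackGroup) : H ⊗[ℝ] (H ⊗[ℝ] H) →ₐ[ℝ] ℝ :=
  Algebra.TensorProduct.productMap (eval c) (eval₂ d e)

theorem eval₃_injective {s t : H ⊗[ℝ] (H ⊗[ℝ] H)}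
    (h : ∀ c d e, eval₃ c d e s = eval₃ c d e t) : s = t :=
  productMap_separates (g := fun p : FeedbackGroup × FeedbackGroup => eval₂ p.1 p.2)
    (fun _ _ => eval_injective) (fun _ _ h => eval₂_injective fun c d => h (c, d))
    fun c p => h c p.1 p.2

/-! ### Graded pieces -/

theorem a_mem (η : Word) : a η ∈ Hn (wt η + 1) :=
  MvPolynomial.isWeightedHomogeneous_X ℝ deg (Gen.a η)

instance : SetLike.GradedMonoid Hn :=
  MvPolynomial.WeightedHomogeneousSubmodule.gradedMonoid

theorem one_mem_Hn : (1 : H) ∈ Hn 0 := SetLike.GradedOne.one_mem (A := Hn)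

theorem b_mem (η : Word) : b η ∈ Hn (wt η) := by
  unfold b
  split_ifs with h
  · subst h
    exact one_mem_Hn
  · exact MvPolynomial.isWeightedHomogeneous_X ℝ deg (Gen.b η h)

theorem aeval_mem {A : Type*} [CommRing A] [Algebra ℝ A] {𝒜 : ℕ → Submodule ℝ A}
    [SetLike.GradedMonoid 𝒜] {t : Gen → A} (ht : ∀ g, t g ∈ 𝒜 (deg g)) {n : ℕ} {h : H}
    (hh : h ∈ Hn n) : MvPolynomial.aeval t h ∈ 𝒜 n := by
  rw [MvPolynomial.aeval_def, MvPolynomial.eval₂_eq]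
  refine sum_mem fun d hd => ?_
  rw [← Algebra.smul_def]
  refine Submodule.smul_mem _ _ ?_
  have h1 : Finsupp.weight deg d = n := hh (MvPolynomial.mem_support_iff.1 hd)
  have h2 := SetLike.prod_pow_mem_graded 𝒜 (F := d.support) (i := deg) (g := t) d fun k _ => ht k
  rwa [show ∑ k ∈ d.support, d k • deg k = n from h1] at h2

/-- The span of the tensors `x ⊗ y` of homogeneous elements with degrees adding up to `n`. -/
noncomputable def tensorPiece (n : ℕ) : Submodule ℝ (H ⊗[ℝ] H) :=
  Submodule.span ℝ {t | ∃ i j, i + j = n ∧ ∃ x ∈ Hn i, ∃ y ∈ Hn j, x ⊗ₜ[ℝ] y = t}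

theorem tmul_mem_tensorPiece {i j : ℕ} {x y : H} (hx : x ∈ Hn i) (hy : y ∈ Hn j) :
    x ⊗ₜ[ℝ] y ∈ tensorPiece (i + j) :=
  Submodule.subset_span ⟨i, j, rfl, x, hx, y, hy, rfl⟩

theorem tmul_one_mem_tensorPiece {i : ℕ} {x : H} (hx : x ∈ Hn i) :
    x ⊗ₜ[ℝ] (1 : H) ∈ tensorPiece i := by
  have h := tmul_mem_tensorPiece hx one_mem_Hn
  rwa [add_zero] at h

theorem one_tmul_mem_tensorPiece {i : ℕ} {x : H} (hx : x ∈ Hn i) :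
    (1 : H) ⊗ₜ[ℝ] x ∈ tensorPiece i := by
  have h := tmul_mem_tensorPiece one_mem_Hn hx
  rwa [zero_add] at h

instance : SetLike.GradedMonoid tensorPiece where
  one_mem := by
    rw [Algebra.TensorProduct.one_def]
    exact tmul_one_mem_tensorPiece one_mem_Hn
  mul_mem := by
    intro m n s t hs ht
    have h : tensorPiece m * tensorPiece n ≤ tensorPiece (m + n) := by
      unfold tensorPiece
      rw [Submodule.span_mul_span, Submodule.span_le]
      rintro _ ⟨_, ⟨i, j, rfl, x, hx, y, hy, rfl⟩, _, ⟨k, l, rfl, z, hz, w, hw, rfl⟩, rfl⟩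
      refine Submodule.subset_span ⟨i + k, j + l, by ring, x * z, SetLike.mul_mem_graded hx hz,
        y * w, SetLike.mul_mem_graded hy hw, ?_⟩
      simp
    exact h (Submodule.mul_mem_mul hs ht)

theorem tensorPiece_le (n : ℕ) : tensorPiece n ≤
    ⨆ p ∈ Finset.HasAntidiagonal.antidiagonal n,
      LinearMap.range (TensorProduct.map (Hn p.1).subtype (Hn p.2).subtype) := by
  refine Submodule.span_le.2 ?_
  rintro _ ⟨i, j, hij, x, hx, y, hy, rfl⟩
  refine Submodule.mem_iSup_of_mem (i, j) (Submodule.mem_iSup_of_mem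
    (Finset.HasAntidiagonal.mem_antidiagonal.2 hij) ⟨(⟨x, hx⟩ : Hn i) ⊗ₜ (⟨y, hy⟩ : Hn j), ?_⟩)
  simp

/-- The functions on `X` represented by a graded piece of an algebra of functions on `X`. -/
noncomputable def functionPiece {X A : Type*} [CommRing A] [Algebra ℝ A]
    (ev : A →ₐ[ℝ] (X → ℝ)) (𝒜 : ℕ → Submodule ℝ A) (n : ℕ) : Submodule ℝ (X → ℝ) :=
  (𝒜 n).map ev.toLinearMap

/-- This lets the homogeneity lemmas run on honest functions; membership in a piece then supplies a
representing element together with its degree. -/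
instance {X A : Type*} [CommRing A] [Algebra ℝ A] (ev : A →ₐ[ℝ] (X → ℝ))
    (𝒜 : ℕ → Submodule ℝ A) [SetLike.GradedMonoid 𝒜] :
    SetLike.GradedMonoid (functionPiece ev 𝒜) where
  one_mem := ⟨1, SetLike.GradedOne.one_mem (A := 𝒜), map_one ev⟩
  mul_mem := by
    rintro m n _ _ ⟨s, hs, rfl⟩ ⟨t, ht, rfl⟩
    exact ⟨s * t, SetLike.mul_mem_graded hs ht, map_mul ev s t⟩

/-! ### The coproduct -/

/-- The elements of `H ⊗ H` as functions of pairs of group elements. -/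
noncomputable def evalPair : H ⊗[ℝ] H →ₐ[ℝ] (FeedbackGroup × FeedbackGroup → ℝ) :=
  AlgHom.pi fun p => eval₂ p.1 p.2

/-- The elements of `H` as functions of group elements. -/
noncomputable def evalFun : H →ₐ[ℝ] (FeedbackGroup → ℝ) := AlgHom.pi eval

theorem exists_comul (g : Gen) :
    ∃ t ∈ tensorPiece (deg g), ∀ c d, eval₂ c d t = Gen.value (comp c d) g := by
  have h := isHomogeneousAt_comp (F := functionPiece evalPair tensorPiece)
    (c := Prod.fst) (d := Prod.snd)
    (fun μ => ⟨b μ ⊗ₜ 1, tmul_one_mem_tensorPiece (b_mem μ),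
      funext fun p => by simp [evalPair, eval₂, eval_b]⟩)
    (fun μ => ⟨a μ ⊗ₜ 1, tmul_one_mem_tensorPiece (a_mem μ),
      funext fun p => by simp [evalPair, eval₂, eval_a]⟩)
    (fun μ => ⟨1 ⊗ₜ b μ, one_tmul_mem_tensorPiece (b_mem μ),
      funext fun p => by simp [evalPair, eval₂, eval_b]⟩)
    (fun μ => ⟨1 ⊗ₜ a μ, one_tmul_mem_tensorPiece (a_mem μ),
      funext fun p => by simp [evalPair, eval₂, eval_a]⟩)
  cases g with
  | a η =>
    obtain ⟨t, ht, he⟩ := (h η).2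
    exact ⟨t, ht, fun c d => congrFun he (c, d)⟩
  | b η hη =>
    obtain ⟨t, ht, he⟩ := (h η).1
    exact ⟨t, ht, fun c d => congrFun he (c, d)⟩

theorem exists_antipode (g : Gen) :
    ∃ t ∈ Hn (deg g), ∀ c, eval c t = Gen.value (inverse c) g := by
  have h := isHomogeneousAt_inverse (F := functionPiece evalFun Hn) (c := id)
    (fun μ => ⟨b μ, b_mem μ, funext fun c => eval_b c μ⟩)
    (fun μ => ⟨a μ, a_mem μ, funext fun c => eval_a c μ⟩)
  cases g with
  | a η =>
    obtain ⟨t, ht, he⟩ := (h η).2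
    exact ⟨t, ht, fun c => congrFun he c⟩
  | b η hη =>
    obtain ⟨t, ht, he⟩ := (h η).1
    exact ⟨t, ht, fun c => congrFun he c⟩

/-- The coproduct of `H`, dual to the composition product. -/
noncomputable def comul : H →ₐ[ℝ] H ⊗[ℝ] H := MvPolynomial.aeval fun g => (exists_comul g).choose

/-- The antipode of `H`, dual to the inversion. -/
noncomputable def antipodeHom : H →ₐ[ℝ] H :=
  MvPolynomial.aeval fun g => (exists_antipode g).choose

theorem eval₂_comul (c d : FeedbackGroup) (h : H) : eval₂ c d (comul h) = eval (comp c d) h := by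
  suffices H : (eval₂ c d).comp comul = eval (comp c d) from DFunLike.congr_fun H h
  refine MvPolynomial.algHom_ext fun g => ?_
  simpa [comul, eval] using (exists_comul g).choose_spec.2 c d

theorem eval_antipodeHom (c : FeedbackGroup) (h : H) :
    eval c (antipodeHom h) = eval (inverse c) h := by
  suffices H : (eval c).comp antipodeHom = eval (inverse c) from DFunLike.congr_fun H h
  refine MvPolynomial.algHom_ext fun g => ?_
  simpa [antipodeHom, eval] using (exists_antipode g).choose_spec.2 c

theorem eval_unitPair (h : H) : eval unitPair h = counit h := by
  suffices H : eval unitPair = counit from DFunLike.congr_fun H h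
  refine MvPolynomial.algHom_ext fun g => ?_
  cases g with
  | a η => simp [eval, counit, Gen.value, unitPair]
  | b η hη => simp [eval, counit, Gen.value, unitPair, oneSeries, hη]

/-! ### The Hopf algebra -/

/-- At `(c, d, e)` the two sides evaluate `h` at the two bracketings of the triple composite. -/
theorem comul_coassoc : (Algebra.TensorProduct.assoc ℝ ℝ ℝ H H H).toAlgHom.comp
    ((Algebra.TensorProduct.map comul (.id ℝ H)).comp comul) =
      (Algebra.TensorProduct.map (.id ℝ H) comul).comp comul := by
  refine AlgHom.ext fun h => eval₃_injective fun c d e => ?_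
  have hl : ((eval₃ c d e).comp (Algebra.TensorProduct.assoc ℝ ℝ ℝ H H H).toAlgHom).comp
      (Algebra.TensorProduct.map comul (.id ℝ H)) = eval₂ (comp c d) e := by
    have h1 : (eval₃ c d e).comp (Algebra.TensorProduct.assoc ℝ ℝ ℝ H H H).toAlgHom =
        Algebra.TensorProduct.productMap (eval₂ c d) (eval e) := by
      refine Algebra.TensorProduct.ext (Algebra.TensorProduct.ext ?_ ?_) ?_ <;>
      · ext x
        simp [eval₃, eval₂, Algebra.TensorProduct.one_def]
    rw [h1]
    refine Algebra.TensorProduct.ext (AlgHom.ext fun x => ?_) (AlgHom.ext fun x => ?_)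
    · simp [eval₂_comul]
      simp [eval₂]
    · simp [eval₂]
  have hr : (eval₃ c d e).comp (Algebra.TensorProduct.map (.id ℝ H) comul) =
      eval₂ c (comp d e) := by
    refine Algebra.TensorProduct.ext (AlgHom.ext fun x => ?_) (AlgHom.ext fun x => ?_)
    · simp [eval₃, eval₂]
    · simp [eval₃, eval₂_comul]
      simp [eval₂]
  refine (DFunLike.congr_fun hl (comul h)).trans
    (Eq.trans ?_ (DFunLike.congr_fun hr (comul h)).symm)
  rw [eval₂_comul, eval₂_comul, comp_assoc]

theorem counit_rTensor_comul : (Algebra.TensorProduct.map counit (.id ℝ H)).comp comul =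
    (Algebra.TensorProduct.lid ℝ H).symm := by
  refine AlgHom.ext fun h => (Algebra.TensorProduct.lid ℝ H).injective (eval_injective fun c => ?_)
  have h1 : ((eval c).comp (Algebra.TensorProduct.lid ℝ H).toAlgHom).comp
      (Algebra.TensorProduct.map counit (.id ℝ H)) = eval₂ unitPair c := by
    refine Algebra.TensorProduct.ext (AlgHom.ext fun x => ?_) (AlgHom.ext fun x => ?_)
    · simp [eval₂, eval_unitPair]
    · simp [eval₂]
  refine (DFunLike.congr_fun h1 (comul h)).trans ?_
  rw [eval₂_comul, unit_comp]
  simp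

theorem counit_lTensor_comul : (Algebra.TensorProduct.map (.id ℝ H) counit).comp comul =
    (Algebra.TensorProduct.rid ℝ ℝ H).symm := by
  refine AlgHom.ext fun h =>
    (Algebra.TensorProduct.rid ℝ ℝ H).injective (eval_injective fun c => ?_)
  have h1 : ((eval c).comp (Algebra.TensorProduct.rid ℝ ℝ H).toAlgHom).comp
      (Algebra.TensorProduct.map (.id ℝ H) counit) = eval₂ c unitPair := by
    refine Algebra.TensorProduct.ext (AlgHom.ext fun x => ?_) (AlgHom.ext fun x => ?_)
    · simp [eval₂]
    · simp [eval₂, eval_unitPair]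
  refine (DFunLike.congr_fun h1 (comul h)).trans ?_
  rw [eval₂_comul, comp_unit]
  simp

/-- Evaluation at `c` is multiplicative, so the left side is `comul h` evaluated at `(inverse c,
c)`, that is, `h` at the unit. -/
theorem mul_antipode_rTensor (h : H) : LinearMap.mul' ℝ H
    (antipodeHom.toLinearMap.rTensor H (comul h)) = algebraMap ℝ H (counit h) := by
  refine eval_injective fun c => ?_
  have h1 : (eval c).toLinearMap ∘ₗ LinearMap.mul' ℝ H ∘ₗ antipodeHom.toLinearMap.rTensor H =
      (eval₂ (inverse c) c).toLinearMap := by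
    refine TensorProduct.ext' fun x y => ?_
    simp [eval₂, eval_antipodeHom]
  refine (DFunLike.congr_fun h1 (comul h)).trans ?_
  rw [AlgHom.toLinearMap_apply, eval₂_comul, inverse_comp, eval_unitPair, AlgHom.commutes]
  rfl

theorem mul_antipode_lTensor (h : H) : LinearMap.mul' ℝ H
    (antipodeHom.toLinearMap.lTensor H (comul h)) = algebraMap ℝ H (counit h) := by
  refine eval_injective fun c => ?_
  have h1 : (eval c).toLinearMap ∘ₗ LinearMap.mul' ℝ H ∘ₗ antipodeHom.toLinearMap.lTensor H =
      (eval₂ c (inverse c)).toLinearMap := by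
    refine TensorProduct.ext' fun x y => ?_
    simp [eval₂, eval_antipodeHom]
  refine (DFunLike.congr_fun h1 (comul h)).trans ?_
  rw [AlgHom.toLinearMap_apply, eval₂_comul, comp_inverse, eval_unitPair, AlgHom.commutes]
  rfl

theorem isHopf_comul : IsHopf comul counit antipodeHom.toLinearMap :=
  ⟨comul_coassoc, counit_rTensor_comul, counit_lTensor_comul,
    { toBialgebra := Bialgebra.ofAlgHom comul counit comul_coassoc counit_rTensor_comul
        counit_lTensor_comul
      antipode := antipodeHom.toLinearMap
      mul_antipode_rTensor_comul := LinearMap.ext mul_antipode_rTensor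
      mul_antipode_lTensor_comul := LinearMap.ext mul_antipode_lTensor }, rfl, fun _ => rfl⟩

/-! ### Connectedness of the grading -/

theorem deg_pos (g : Gen) : 0 < deg g := by
  cases g with
  | a η => exact Nat.succ_pos _
  | b η hη => exact wt_pos hη

theorem Hn_zero : Hn 0 = Submodule.span ℝ {1} := by
  classical
  apply le_antisymm
  · intro h hh
    have hc : h = MvPolynomial.C (h.coeff 0) := by
      ext d
      rw [MvPolynomial.coeff_C]
      split_ifs with hd
      · rw [hd]
      · by_contra hne
        have h0 : Finsupp.weight deg d = 0 := hh hne
        apply hd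
        symm
        ext g
        by_contra hg
        -- A generator occurring in a monomial contributes at least its own degree, which is
        -- positive.
        have h1 := Finsupp.le_weight_of_ne_zero' (w := deg) (f := d) (s := g) hg
        have := deg_pos g
        omega
    rw [hc, ← mul_one (MvPolynomial.C _), ← MvPolynomial.smul_eq_C_mul]
    exact Submodule.smul_mem _ _ (Submodule.mem_span_singleton_self 1)
  · rw [Submodule.span_singleton_le_iff_mem]
    exact one_mem_Hn

theorem counit_eq_zero {n : ℕ} (hn : n ≠ 0) {h : H} (hh : h ∈ Hn n) : counit h = 0 := by
  unfold counit
  rw [MvPolynomial.aeval_zero']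
  by_contra hne
  have h0 : MvPolynomial.coeff 0 h ≠ 0 := by simpa [MvPolynomial.constantCoeff] using hne
  exact hn (by simpa using (hh h0).symm)

theorem isConnectedGradedHopf_comul :
    IsConnectedGradedHopf Hn comul counit antipodeHom.toLinearMap where
  isHopf := isHopf_comul
  gradedAlgebra := ⟨MvPolynomial.weightedGradedAlgebra ℝ deg⟩
  connected := Hn_zero
  comul_mem n _ hx := tensorPiece_le n (aeval_mem (fun g => (exists_comul g).choose_spec.1) hx)
  counit_eq_zero _ hn _ hx := counit_eq_zero hn hx
  antipode_mem _ _ hx := aeval_mem (fun g => (exists_antipode g).choose_spec.1) hx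

end AffineFeedback

theorem mainTheorem2 :
    ∃ (Δ : AffineFeedback.H →ₐ[ℝ] AffineFeedback.H ⊗[ℝ] AffineFeedback.H)
      (S : AffineFeedback.H →ₗ[ℝ] AffineFeedback.H),
      -- `Δ h` is the one and only element of `H ⊗ H` dual to the composition product
      (∀ (h : AffineFeedback.H) (t : AffineFeedback.H ⊗[ℝ] AffineFeedback.H),
        (∀ c d : AffineFeedback.FeedbackGroup,
          AffineFeedback.eval₂ c d t = AffineFeedback.eval (AffineFeedback.comp c d) h) ↔
        t = Δ h) ∧
      AffineFeedback.IsConnectedGradedHopf AffineFeedback.Hn Δ AffineFeedback.counit S ∧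
      (∀ x y : AffineFeedback.H, S (x * y) = S y * S x) ∧
      -- the composition product is a group law, and `S` computes its inverses
      ∃ grp : Group AffineFeedback.FeedbackGroup,
        (∀ c d : AffineFeedback.FeedbackGroup, grp.mul c d = AffineFeedback.comp c d) ∧
        grp.one = AffineFeedback.unitPair ∧
        (∀ (c : AffineFeedback.FeedbackGroup) (h : AffineFeedback.H),
          AffineFeedback.eval (grp.inv c) h = AffineFeedback.eval c (S h)) ∧
        ∀ (c : AffineFeedback.FeedbackGroup) (η : AffineFeedback.Word),
          (grp.inv c).1.1 η = AffineFeedback.eval c (S (AffineFeedback.b η)) ∧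
          (grp.inv c).1.2 η = AffineFeedback.eval c (S (AffineFeedback.a η)) := by
  open AffineFeedback in
  refine ⟨comul, antipodeHom.toLinearMap, fun h t => ⟨fun ht => ?_, fun ht c d => ?_⟩,
    isConnectedGradedHopf_comul, fun x y => ?_, feedbackGroup, fun _ _ => rfl, rfl,
    fun c h => (eval_antipodeHom c h).symm, fun c η => ⟨?_, ?_⟩⟩
  · exact eval₂_injective fun c d => by rw [ht, eval₂_comul]
  · rw [ht, eval₂_comul]
  -- The antipode is an algebra homomorphism; reversing the factors uses commutativity.
  · rw [AlgHom.toLinearMap_apply, map_mul, mul_comm]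
    rfl
  · exact ((eval_antipodeHom c (b η)).trans (eval_b _ η)).symm
  · exact ((eval_antipodeHom c (a η)).trans (eval_a _ η)).symm
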